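/- In the longest palindromic substring problem, the input is a string $A\in\{0,1\}^n$, and a substring is a block of consecutive characters. Let $d(A)$ be the maximum length of a substring of $A$ that reads the same forward and backward. For $c\in(0,1]$, a $c$-approximation is (the interval of positions of) a palindromic substring of $A$ of length at least $c\cdot d(A)$; in the version of the problem where only the length is wanted, it is a number $\ell$ with $c\cdot d(A)\le \ell\le d(A)$. A quantum algorithm for strings of length $n$ acts on an index register $i\in\{1,\dots,n\}$, an answer bit $a$ and an arbitrary finite-dimensional work register $z$. It starts in a fixed basis state, performs a fixed sequence of steps, each of which is either a call to the oracle $O_A\colon |i\rangle|a\rangle|z\rangle\mapsto|i\rangle|a\oplus A[i]\rangle|z\rangle$ or a unitary operator that does not depend on $A$, then measures in the computational basis and returns a function of the outcome. Its running time is the number of steps: an oracle call has unit cost, and so has every input-independent unitary operator (in particular every elementary gate). It solves a problem with high probability if, on every input $A\in\{0,1\}^n$, its result is correct with probability at least $9/10$. **Theorem.** For any constant $c\in(0,1]$, any quantum algorithm that computes with high probability a $c$-approximation of the longest palindromic substring of a binary string of length $n$ requires $\Omega(\sqrt n)$ time. That is, for every $c\in(0,1]$ there are $\kappa>0$ and $N$,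 depending only on $c$, such that for all $n\ge N$ every quantum algorithm for binary strings of length $n$ that outputs with high probability a $c$-approximate solution has running time at least $\kappa\sqrt n$. The same holds for every quantum algorithm that outputs with high probability only a $c$-approximation of the length. -/

import Mathlib

namespace QuantumLPS

/-! ### Strings and palindromic substrings -/

/-- `IsPalSubstring x w`: the word `w` is a substring (a block of consecutive characters) of the
binary string `x` of length `n` and reads the same forward and backward. -/
def IsPalSubstring {n : ℕ} (x : Fin n → Bool) (w : List Bool) : Prop :=
  w <:+: List.ofFn x ∧ w.Palindrome

/-- The length of a longest palindromic substring of `x`. -/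
noncomputable def lpsLength {n : ℕ} (x : Fin n → Bool) : ℕ :=
  sSup {d : ℕ | ∃ w : List Bool, IsPalSubstring x w ∧ w.length = d}

/-- The supremum defining `lpsLength` is attained. -/
theorem isGreatest_lpsLength {n : ℕ} (x : Fin n → Bool) :
    IsGreatest {d : ℕ | ∃ w : List Bool, IsPalSubstring x w ∧ w.length = d} (lpsLength x) := by
  have hb : BddAbove {d : ℕ | ∃ w : List Bool, IsPalSubstring x w ∧ w.length = d} := by
    refine ⟨n, ?_⟩
    rintro d ⟨w, hw, rfl⟩
    simpa using hw.1.length_le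
  refine ⟨Nat.sSup_mem ⟨0, [], ⟨List.nil_infix, List.Palindrome.nil⟩, rfl⟩ hb, ?_⟩
  intro d hd
  exact le_csSup hb hd

/-- The substring of `x` that occupies the positions `i, …, j - 1` (counted from `0`). -/
def substring {n : ℕ} (x : Fin n → Bool) (i j : ℕ) : List Bool :=
  ((List.ofFn x).drop i).take (j - i)

/-- The interval `[i, j)` of positions is a `c`-approximate solution of the longest palindromic
substring problem on `x`: the substring there is a palindrome, and its length `j - i` is at least
`c` times the length of a longest palindromic substring. -/
def IsApproxSolution {n : ℕ} (c : ℝ) (x : Fin n → Bool) (p : ℕ × ℕ) : Prop :=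
  p.1 ≤ p.2 ∧ p.2 ≤ n ∧ (substring x p.1 p.2).Palindrome ∧
    c * (lpsLength x : ℝ) ≤ ((p.2 - p.1 : ℕ) : ℝ)

/-- The number `l` is a `c`-approximation of the length `d` of a longest palindromic substring of
`x`, that is, `c * d ≤ l ≤ d`. -/
def IsApproxLength {n : ℕ} (c : ℝ) (x : Fin n → Bool) (l : ℝ) : Prop :=
  c * (lpsLength x : ℝ) ≤ l ∧ l ≤ (lpsLength x : ℝ)

/-! ### Quantum algorithms with oracle access to a binary string -/

/-- Classical configurations: an index register `i`, an answer bit `a` and a work register `z`. -/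
abbrev Config (n : ℕ) (W : Type) : Type := Fin n × Bool × W

/-- (Not necessarily normalized) state vectors, with one amplitude for each configuration. -/
abbrev State (n : ℕ) (W : Type) [Fintype W] : Type := EuclideanSpace ℂ (Config n W)

/-- The permutation `(i, a, z) ↦ (i, a ⊕ x i, z)` of the configurations. -/
def oraclePerm {n : ℕ} {W : Type} (x : Fin n → Bool) : Config n W ≃ Config n W where
  toFun s := (s.1, xor s.2.1 (x s.1), s.2.2)
  invFun s := (s.1, xor s.2.1 (x s.1), s.2.2)
  left_inv s := by simp
  right_inv s := by simp

/-- The oracle for `x`: the unitary operator with `|i⟩|a⟩|z⟩ ↦ |i⟩|a ⊕ x i⟩|z⟩`. -/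
noncomputable def oracle {n : ℕ} {W : Type} [Fintype W] (x : Fin n → Bool) :
    State n W ≃ₗᵢ[ℂ] State n W :=
  LinearIsometryEquiv.piLpCongrLeft 2 ℂ ℂ (oraclePerm x)

theorem oracle_single {n : ℕ} {W : Type} [Fintype W] [DecidableEq W] (x : Fin n → Bool)
    (i : Fin n) (a : Bool) (z : W) :
    oracle x (EuclideanSpace.single ((i, a, z) : Config n W) (1 : ℂ)) =
      EuclideanSpace.single ((i, xor a (x i), z) : Config n W) (1 : ℂ) := by
  unfold oracle
  rw [LinearIsometryEquiv.piLpCongrLeft_single]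
  rfl

/-- One step of a quantum algorithm: a call to the oracle, or a unitary operator that does not
depend on the input. -/
inductive Step (n : ℕ) (W : Type) [Fintype W] : Type
  | query : Step n W
  | gate (U : State n W ≃ₗᵢ[ℂ] State n W) : Step n W

/-- The unitary operator that a step performs when the input is `x`. -/
noncomputable def Step.op {n : ℕ} {W : Type} [Fintype W] (x : Fin n → Bool) :
    Step n W → (State n W ≃ₗᵢ[ℂ] State n W)
  | .query => oracle x
  | .gate U => U

/-- A quantum algorithm for binary input strings of length `n`, with work register `W` and results
in `R`: it starts in a fixed basis state, performs the steps of `steps` in order, measures all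
registers in the computational basis and returns a function of the measured configuration. -/
structure QuantumAlgorithm (n : ℕ) (W : Type) [Fintype W] (R : Type) : Type where
  init : Config n W
  steps : List (Step n W)
  result : Config n W → R

namespace QuantumAlgorithm

variable {n : ℕ} {W : Type} [Fintype W] {R : Type}

/-- The running time: the number of steps. An oracle call has cost one, and so has *every*
input-independent unitary operator, whatever its size (hence in particular each elementary gate
of any gate set). -/
def time (Q : QuantumAlgorithm n W R) : ℕ := Q.steps.length

open Classical in
/-- The state of the algorithm on input `x` just before the measurement. -/
noncomputable def finalState (Q : QuantumAlgorithm n W R) (x : Fin n → Bool) : State n W :=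
  Q.steps.foldl (fun ψ s => s.op x ψ) (EuclideanSpace.single Q.init 1)

open Classical in
/-- The probability (by the Born rule) that the result of the algorithm on input `x` satisfies
`P`. -/
noncomputable def prob (Q : QuantumAlgorithm n W R) (x : Fin n → Bool) (P : R → Prop) : ℝ :=
  ∑ s : Config n W, if P (Q.result s) then ‖Q.finalState x s‖ ^ 2 else 0

/-- The algorithm solves, with high probability (at least `9/10` on every input), the problem in
which `Sol x r` says that `r` is a correct result for the input `x`. -/
def SolvesWHP (Q : QuantumAlgorithm n W R) (Sol : (Fin n → Bool) → R → Prop) : Prop :=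
  ∀ x : Fin n → Bool, 9 / 10 ≤ Q.prob x (Sol x)

end QuantumAlgorithm

end QuantumLPS

namespace QuantumLPS

open Finset

/-! ### The hybrid argument -/

section Hybrid

variable {n : ℕ} {W : Type} [Fintype W]

/-! This is a hybrid argument. The periodic word `001011…` has no palindrome longer than 4, while
zeroing any one block of length `L > 4 / c` creates one of length at least `L`. No result is correct
for both strings, so the algorithm must tell the base string from each of its `n / L` modifications.
On the base string, each step has total query weight at most 1 to share among the disjoint blocks.
Separating the final states for every block (`SolvesWHP.le_norm_finalState_sub_sq`) therefore forces
the squared time to be of order `n / L` (`SolvesWHP.le_time_sq`). -/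

theorem oracle_apply (x : Fin n → Bool) (ψ : State n W) (s : Config n W) :
    oracle x ψ s = ψ (oraclePerm x s) := rfl

/-- The weight that the state `ψ` puts on the indices `i` with `p i`. -/
noncomputable def indexWeight (p : Fin n → Prop) [DecidablePred p] (ψ : State n W) : ℝ :=
  ∑ s : Config n W, if p s.1 then ‖ψ s‖ ^ 2 else 0

theorem indexWeight_nonneg (p : Fin n → Prop) [DecidablePred p] (ψ : State n W) :
    0 ≤ indexWeight p ψ :=
  Finset.sum_nonneg fun s _ => by split_ifs <;> positivity

theorem indexWeight_comp_oraclePerm (p : Fin n → Prop) [DecidablePred p] (x : Fin n → Bool)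
    (ψ : State n W) :
    ∑ s : Config n W, (if p s.1 then ‖ψ (oraclePerm x s)‖ ^ 2 else 0) = indexWeight p ψ :=
  Equiv.sum_comp (oraclePerm x) fun s : Config n W => if p s.1 then ‖ψ s‖ ^ 2 else 0

theorem norm_sub_sq_le {E : Type*} [SeminormedAddCommGroup E] (a b : E) :
    ‖a - b‖ ^ 2 ≤ 2 * ‖a‖ ^ 2 + 2 * ‖b‖ ^ 2 := by
  have h := norm_sub_le a b
  have h0 := norm_nonneg (a - b)
  nlinarith [sq_nonneg (‖a‖ - ‖b‖)]

/-- Two oracles that agree outside `p` act similarly on a state with little weight on `p`. -/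
theorem norm_oracle_sub_oracle_le (p : Fin n → Prop) [DecidablePred p] {x y : Fin n → Bool}
    (h : ∀ i, ¬ p i → y i = x i) (ψ : State n W) :
    ‖oracle x ψ - oracle y ψ‖ ≤ 2 * √(indexWeight p ψ) := by
  refine le_of_sq_le_sq ?_ (by positivity)
  rw [mul_pow, Real.sq_sqrt (indexWeight_nonneg p ψ), EuclideanSpace.norm_sq_eq]
  calc ∑ s, ‖(oracle x ψ - oracle y ψ) s‖ ^ 2
      ≤ ∑ s : Config n W, (2 * (if p s.1 then ‖ψ (oraclePerm x s)‖ ^ 2 else 0) +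
          2 * (if p s.1 then ‖ψ (oraclePerm y s)‖ ^ 2 else 0)) := by
        refine Finset.sum_le_sum fun s _ => ?_
        rw [PiLp.sub_apply, oracle_apply, oracle_apply]
        split_ifs with hs
        · exact norm_sub_sq_le _ _
        · simp [oraclePerm, h s.1 hs]
    _ = 2 ^ 2 * indexWeight p ψ := by
        rw [Finset.sum_add_distrib, ← Finset.mul_sum, ← Finset.mul_sum,
          indexWeight_comp_oraclePerm, indexWeight_comp_oraclePerm]
        ring

/-- Comparing through `g.op y ψ` charges the new error to `ψ` alone. All weights are thus measured
along the run on `x`, which is the same for every modification `y`. -/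
theorem Step.norm_op_sub_op_le (p : Fin n → Prop) [DecidablePred p] {x y : Fin n → Bool}
    (h : ∀ i, ¬ p i → y i = x i) (g : Step n W) (ψ φ : State n W) :
    ‖g.op x ψ - g.op y φ‖ ≤ ‖ψ - φ‖ + 2 * √(indexWeight p ψ) := by
  have key : ‖g.op x ψ - g.op y ψ‖ ≤ 2 * √(indexWeight p ψ) := by
    cases g with
    | query => exact norm_oracle_sub_oracle_le p h ψ
    | gate U => simp [Step.op]
  have hiso : ‖g.op y ψ - g.op y φ‖ = ‖ψ - φ‖ := by rw [← map_sub, LinearIsometryEquiv.norm_map]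
  linarith [norm_sub_le_norm_sub_add_norm_sub (g.op x ψ) (g.op y ψ) (g.op y φ)]

namespace QuantumAlgorithm

variable {R : Type}

open Classical in
/-- The state of the algorithm on input `x` after its first `t` steps. -/
noncomputable def stateAt (Q : QuantumAlgorithm n W R) (x : Fin n → Bool) (t : ℕ) : State n W :=
  (Q.steps.take t).foldl (fun ψ s => s.op x ψ) (EuclideanSpace.single Q.init 1)

theorem stateAt_time (Q : QuantumAlgorithm n W R) (x : Fin n → Bool) :
    Q.stateAt x Q.time = Q.finalState x := by
  simp [stateAt, finalState, time]

theorem stateAt_succ (Q : QuantumAlgorithm n W R) (x : Fin n → Bool) {t : ℕ}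
    (ht : t < Q.steps.length) :
    Q.stateAt x (t + 1) = (Q.steps[t]).op x (Q.stateAt x t) := by
  rw [stateAt, stateAt, List.take_succ_eq_append_getElem ht, List.foldl_append, List.foldl_cons,
    List.foldl_nil]

theorem norm_stateAt (Q : QuantumAlgorithm n W R) (x : Fin n → Bool) {t : ℕ}
    (ht : t ≤ Q.time) : ‖Q.stateAt x t‖ = 1 := by
  induction t with
  | zero => simp [stateAt]
  | succ t ih => rw [stateAt_succ Q x ht, LinearIsometryEquiv.norm_map, ih (by omega)]

theorem norm_stateAt_sub_le (Q : QuantumAlgorithm n W R) (p : Fin n → Prop) [DecidablePred p]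
    {x y : Fin n → Bool} (h : ∀ i, ¬ p i → y i = x i) {t : ℕ} (ht : t ≤ Q.time) :
    ‖Q.stateAt x t - Q.stateAt y t‖ ≤ ∑ u ∈ range t, 2 * √(indexWeight p (Q.stateAt x u)) := by
  induction t with
  | zero => simp [stateAt]
  | succ t ih =>
    rw [stateAt_succ Q x ht, stateAt_succ Q y ht, Finset.sum_range_succ]
    linarith [Step.norm_op_sub_op_le p h Q.steps[t] (Q.stateAt x t) (Q.stateAt y t),
      ih (by omega)]

theorem norm_finalState_sub_sq_le (Q : QuantumAlgorithm n W R) (p : Fin n → Prop)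
    [DecidablePred p] {x y : Fin n → Bool} (h : ∀ i, ¬ p i → y i = x i) :
    ‖Q.finalState x - Q.finalState y‖ ^ 2 ≤
      4 * Q.time * ∑ u ∈ range Q.time, indexWeight p (Q.stateAt x u) := by
  have h1 := Q.norm_stateAt_sub_le p h le_rfl
  rw [stateAt_time, stateAt_time] at h1
  -- Cauchy–Schwarz over the steps costs one factor `Q.time`.
  refine (pow_le_pow_left₀ (norm_nonneg _) h1 2).trans (sq_sum_le_card_mul_sum_sq.trans_eq ?_)
  simp_rw [mul_pow, Real.sq_sqrt (indexWeight_nonneg p _), ← Finset.mul_sum, card_range]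
  ring

theorem prob_add_prob_le_one (Q : QuantumAlgorithm n W R) (x : Fin n → Bool) {P P' : R → Prop}
    (h : ∀ r, P r → ¬ P' r) : Q.prob x P + Q.prob x P' ≤ 1 := by
  have h1 : ∑ s, ‖Q.finalState x s‖ ^ 2 = 1 := by
    rw [← EuclideanSpace.norm_sq_eq, ← stateAt_time, Q.norm_stateAt x le_rfl, one_pow]
  rw [← h1, prob, prob, ← Finset.sum_add_distrib]
  refine Finset.sum_le_sum fun s _ => ?_
  have := h (Q.result s)
  split_ifs <;> simp_all

theorem prob_le (Q : QuantumAlgorithm n W R) (x y : Fin n → Bool) (P : R → Prop) :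
    Q.prob x P ≤ 2 * Q.prob y P + 2 * ‖Q.finalState x - Q.finalState y‖ ^ 2 := by
  rw [EuclideanSpace.norm_sq_eq, prob, prob, Finset.mul_sum, Finset.mul_sum,
    ← Finset.sum_add_distrib]
  refine Finset.sum_le_sum fun s _ => ?_
  rw [PiLp.sub_apply]
  split_ifs
  · simpa [norm_sub_rev] using
      norm_sub_sq_le (Q.finalState y s) (Q.finalState y s - Q.finalState x s)
  · positivity

/-- Inputs with disjoint sets of correct results lead to final states that are far apart. -/
theorem SolvesWHP.le_norm_finalState_sub_sq {Q : QuantumAlgorithm n W R}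
    {Sol : (Fin n → Bool) → R → Prop} (hQ : Q.SolvesWHP Sol) {x y : Fin n → Bool}
    (h : ∀ r, Sol x r → ¬ Sol y r) :
    7 / 20 ≤ ‖Q.finalState x - Q.finalState y‖ ^ 2 := by
  -- A result correct for `x` has probability at most `1/10` on `y`, so `9/10 ≤ 2 * (1/10) + 2 * δ`
  -- for the squared distance `δ`.
  linarith [hQ x, hQ y, Q.prob_add_prob_le_one y h, Q.prob_le x y (Sol x)]

/-- Each index lies in a single block, so each amplitude is counted at most once. -/
theorem sum_indexWeight_le (b : Fin n → ℕ) (m : ℕ) (ψ : State n W) :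
    ∑ k ∈ range m, indexWeight (fun i => b i = k) ψ ≤ ‖ψ‖ ^ 2 := by
  simp only [indexWeight]
  rw [Finset.sum_comm, EuclideanSpace.norm_sq_eq]
  refine Finset.sum_le_sum fun s _ => ?_
  rw [Finset.sum_ite_eq]
  split_ifs
  · exact le_rfl
  · positivity

/-- If modifying the input `x` inside any one of `m` disjoint blocks of positions invalidates all
correct results, then every algorithm needs `Ω(√m)` steps. -/
theorem SolvesWHP.le_time_sq {Q : QuantumAlgorithm n W R}
    {Sol : (Fin n → Bool) → R → Prop} (hQ : Q.SolvesWHP Sol) (b : Fin n → ℕ) (m : ℕ)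
    (x : Fin n → Bool) (y : ℕ → Fin n → Bool) (hy : ∀ k i, b i ≠ k → y k i = x i)
    (h : ∀ k < m, ∀ r, Sol x r → ¬ Sol (y k) r) :
    7 / 80 * (m : ℝ) ≤ (Q.time : ℝ) ^ 2 := by
  have h1 : ∑ k ∈ range m, (7 / 20 : ℝ) ≤ ∑ k ∈ range m,
      4 * Q.time * ∑ u ∈ range Q.time, indexWeight (fun i => b i = k) (Q.stateAt x u) :=
    Finset.sum_le_sum fun k hk =>
      (hQ.le_norm_finalState_sub_sq (h k (mem_range.1 hk))).trans
        (Q.norm_finalState_sub_sq_le (fun i => b i = k) (hy k))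
  have h2 : ∑ u ∈ range Q.time, ∑ k ∈ range m,
      indexWeight (fun i => b i = k) (Q.stateAt x u) ≤ ∑ u ∈ range Q.time, (1 : ℝ) := by
    refine Finset.sum_le_sum fun u hu => (sum_indexWeight_le b m _).trans_eq ?_
    rw [Q.norm_stateAt x (mem_range.1 hu).le, one_pow]
  rw [← Finset.mul_sum, Finset.sum_comm] at h1
  simp only [Finset.sum_const, card_range, nsmul_eq_mul, mul_one] at h1 h2
  have h3 := mul_le_mul_of_nonneg_left h2 (show (0 : ℝ) ≤ 4 * Q.time by positivity)
  linarith

end QuantumAlgorithm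

end Hybrid

/-! ### A string without long palindromes, and its modifications -/

/-- The periodic word `001011 001011 …`. -/
def periodicBit (i : ℕ) : Bool := i % 6 = 2 ∨ i % 6 = 4 ∨ i % 6 = 5

/-- The two parts exclude palindromes of lengths 5 and 6; by periodicity six starting points
suffice. -/
theorem periodicBit_asymm (a : ℕ) :
    ¬ (periodicBit a = periodicBit (a + 4) ∧ periodicBit (a + 1) = periodicBit (a + 3)) ∧
    ¬ (periodicBit a = periodicBit (a + 5) ∧ periodicBit (a + 1) = periodicBit (a + 4) ∧
      periodicBit (a + 2) = periodicBit (a + 3)) := by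
  have h : a % 6 < 6 := Nat.mod_lt _ (by norm_num)
  simp only [periodicBit, Nat.add_mod a]
  interval_cases a % 6 <;> decide

/-- The prefix of length `n` of `001011 001011 …`. -/
def baseString (n : ℕ) : Fin n → Bool := fun i => periodicBit i

theorem length_le_of_isPalSubstring_baseString {n : ℕ} {w : List Bool}
    (h : IsPalSubstring (baseString n) w) : w.length ≤ 4 := by
  obtain ⟨⟨u, v, huv⟩, hp⟩ := h
  have hget : ∀ j (hj : j < w.length), w[j] = periodicBit (u.length + j) := by
    intro j hj
    have hlen := congrArg List.length huv
    simp only [List.length_append, List.length_ofFn] at hlen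
    have h1 : (List.ofFn (baseString n))[u.length + j]? = some w[j] := by
      rw [← huv, List.append_assoc, List.getElem?_append_right (by omega),
        Nat.add_sub_cancel_left, List.getElem?_append_left hj, List.getElem?_eq_getElem hj]
    rw [List.getElem?_eq_getElem (by simp; omega)] at h1
    simpa [baseString] using h1.symm
  have hsymm : ∀ j k, j + k + 1 = w.length →
      periodicBit (u.length + j) = periodicBit (u.length + k) := by
    intro j k hjk
    rw [← hget j (by omega), ← hget k (by omega)]
    have h1 : w.reverse[j]'(by simp; omega) = w[j] := by simp only [hp.reverse_eq]
    rw [← h1, List.getElem_reverse]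
    congr 1
    omega
  by_contra! hlt
  -- Removing `a` letters from each end of a longer palindrome would leave one of length 5 or 6.
  obtain ⟨a, ha | ha⟩ : ∃ a, w.length = 2 * a + 5 ∨ w.length = 2 * a + 6 :=
    ⟨(w.length - 5) / 2, by omega⟩
  · exact (periodicBit_asymm (u.length + a)).1
      ⟨hsymm a (a + 4) (by omega), hsymm (a + 1) (a + 3) (by omega)⟩
  · exact (periodicBit_asymm (u.length + a)).2
      ⟨hsymm a (a + 5) (by omega), hsymm (a + 1) (a + 4) (by omega),
        hsymm (a + 2) (a + 3) (by omega)⟩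

theorem lpsLength_baseString_le (n : ℕ) : lpsLength (baseString n) ≤ 4 := by
  obtain ⟨w, hw, hl⟩ := (isGreatest_lpsLength (baseString n)).1
  exact hl ▸ length_le_of_isPalSubstring_baseString hw

/-- `baseString n` with the `k`-th block of length `L` overwritten by zeros. -/
def blockString (n L k : ℕ) : Fin n → Bool :=
  fun i => if (i : ℕ) / L = k then false else periodicBit i

theorem le_lpsLength_blockString {n L k : ℕ} (hk : k < n / L) :
    L ≤ lpsLength (blockString n L k) := by
  -- `n / 0 = 0` leaves no `k` when `L = 0`.
  have hL : 0 < L := Nat.pos_of_ne_zero fun h => by simp [h] at hk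
  have hkn : k * L + L ≤ n := by
    calc k * L + L = (k + 1) * L := by ring
      _ ≤ n / L * L := Nat.mul_le_mul_right _ hk
      _ ≤ n := Nat.div_mul_le_self n L
  refine (isGreatest_lpsLength (blockString n L k)).2 ⟨List.replicate L false, ⟨?_, ?_⟩, by simp⟩
  · have h : List.replicate L false = ((List.ofFn (blockString n L k)).drop (k * L)).take L := by
      refine List.ext_getElem (by simp; omega) fun j h1 h2 => ?_
      have hj : j < L := by simpa using h1
      have hdiv : (k * L + j) / L = k := by
        rw [mul_comm, Nat.mul_add_div hL, Nat.div_eq_of_lt hj, add_zero]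
      simp [blockString, hdiv]
    rw [h]
    exact (List.take_prefix _ _).isInfix.trans (List.drop_suffix _ _).isInfix
  · exact List.Palindrome.of_reverse_eq (by simp)

/-! ### Approximate solutions of strings with different optima -/

theorem IsApproxLength.not_of_lt {n : ℕ} {c : ℝ} {x y : Fin n → Bool}
    (h : (lpsLength x : ℝ) < c * lpsLength y) (l : ℝ) (hx : IsApproxLength c x l) :
    ¬ IsApproxLength c y l := fun hy => by
  linarith [hx.2, hy.1]

theorem IsApproxSolution.le_lpsLength {n : ℕ} {c : ℝ} {x : Fin n → Bool} {p : ℕ × ℕ}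
    (h : IsApproxSolution c x p) : p.2 - p.1 ≤ lpsLength x := by
  obtain ⟨h1, h2, h3, -⟩ := h
  refine (isGreatest_lpsLength x).2 ⟨substring x p.1 p.2, ⟨?_, h3⟩, ?_⟩
  · exact (List.take_prefix _ _).isInfix.trans (List.drop_suffix _ _).isInfix
  · simp [substring]
    omega

theorem IsApproxSolution.not_of_lt {n : ℕ} {c : ℝ} {x y : Fin n → Bool}
    (h : (lpsLength x : ℝ) < c * lpsLength y) (p : ℕ × ℕ) (hx : IsApproxSolution c x p) :
    ¬ IsApproxSolution c y p := fun hy => by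
  have h1 : ((p.2 - p.1 : ℕ) : ℝ) ≤ lpsLength x := by exact_mod_cast hx.le_lpsLength
  linarith [hy.2.2.2]

/-- The lower bound for every problem in which strings whose optima differ by a factor of more
than `1 / c` have no common correct result. -/
theorem QuantumAlgorithm.SolvesWHP.mul_sqrt_le_time {n : ℕ} {W : Type} [Fintype W] {R : Type}
    {Q : QuantumAlgorithm n W R} {Sol : (Fin n → Bool) → R → Prop} (hQ : Q.SolvesWHP Sol)
    {c : ℝ} (hc : 0 < c)
    (hSol : ∀ x y : Fin n → Bool, (lpsLength x : ℝ) < c * lpsLength y →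
      ∀ r, Sol x r → ¬ Sol y r)
    {L : ℕ} (hL : 4 < c * L) (hn : L ≤ n) :
    1 / (10 * (L : ℝ)) * √n ≤ Q.time := by
  have hL0 : 0 < L := Nat.pos_of_ne_zero fun h => by norm_num [h] at hL
  have hLr : (1 : ℝ) ≤ L := by exact_mod_cast hL0
  have h1 := hQ.le_time_sq (fun i => (i : ℕ) / L) (n / L) (baseString n) (blockString n L)
    (fun k i hi => if_neg hi) fun k hk => hSol _ _ <| by
      have h2 : (lpsLength (baseString n) : ℝ) ≤ 4 := by exact_mod_cast lpsLength_baseString_le n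
      have h3 : (L : ℝ) ≤ lpsLength (blockString n L k) := by
        exact_mod_cast le_lpsLength_blockString hk
      linarith [mul_le_mul_of_nonneg_left h3 hc.le]
  -- With at least one full block, the incomplete remainder at most doubles the length.
  have h2 : (n : ℝ) ≤ 2 * L * (n / L : ℕ) := by
    have h3 : 1 ≤ n / L := (Nat.one_le_div_iff hL0).2 hn
    have h4 := Nat.lt_mul_div_succ n hL0
    have h5 : n ≤ 2 * L * (n / L) := by nlinarith
    exact_mod_cast h5
  refine le_of_sq_le_sq ?_ (Nat.cast_nonneg _)
  rw [mul_pow, Real.sq_sqrt (Nat.cast_nonneg n), div_pow, one_pow, div_mul_eq_mul_div, one_mul,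
    div_le_iff₀ (by positivity)]
  have h6 : (L : ℝ) ≤ L ^ 2 := by nlinarith
  have h7 : (0 : ℝ) ≤ (n / L : ℕ) := Nat.cast_nonneg _
  nlinarith [mul_le_mul_of_nonneg_right h6 h7,
    mul_le_mul_of_nonneg_right h1 (show (0 : ℝ) ≤ (10 * L) ^ 2 by positivity)]

end QuantumLPS

theorem theorem9 (c : ℝ) (hc0 : 0 < c) (hc1 : c ≤ 1) :
    ∃ κ : ℝ, 0 < κ ∧ ∃ N : ℕ, ∀ n : ℕ, N ≤ n → ∀ (W : Type) [Fintype W],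
      (∀ Q : QuantumLPS.QuantumAlgorithm n W (ℕ × ℕ),
        Q.SolvesWHP (QuantumLPS.IsApproxSolution c) → κ * Real.sqrt n ≤ (Q.time : ℝ)) ∧
      (∀ Q : QuantumLPS.QuantumAlgorithm n W ℝ,
        Q.SolvesWHP (QuantumLPS.IsApproxLength c) → κ * Real.sqrt n ≤ (Q.time : ℝ)) := by
  -- A zero block of this length beats the base optimum 4 even after scaling by `c`.
  obtain ⟨L, hL⟩ := exists_nat_gt (4 / c)
  have hcL : 4 < c * L := by rwa [div_lt_iff₀' hc0] at hL
  have hL0 : (0 : ℝ) < L := (div_pos four_pos hc0).trans hL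
  exact ⟨1 / (10 * (L : ℝ)), by positivity, L, fun n hn W _ =>
    ⟨fun Q hQ => hQ.mul_sqrt_le_time hc0
      (fun _ _ h => QuantumLPS.IsApproxSolution.not_of_lt h) hcL hn,
    fun Q hQ => hQ.mul_sqrt_le_time hc0
      (fun _ _ h => QuantumLPS.IsApproxLength.not_of_lt h) hcL hn⟩⟩
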